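/- Fix a photon-number cutoff $N_c\in\mathbb N$, and let $A=\mathbb C^4$ with orthonormal basis $|0\rangle,\dots,|3\rangle$ and $B=\mathbb C^{N_c}$ with the Fock basis $|0\rangle,\dots,|N_c-1\rangle$. For $\alpha\in\mathbb C$ let $|\alpha\rangle=\sum_{k<N_c}e^{-|\alpha|^2/2}\frac{\alpha^k}{\sqrt{k!}}|k\rangle\in B$ be the truncated coherent state, and for a set $s\subseteq[0,\infty)$ and $j\in\{0,1,2,3\}$ put $$R(s,j)=\frac1\pi\int_{s}\int_{\frac\pi4(2j-1)}^{\frac\pi4(2j+1)}\gamma\,|\gamma e^{i\theta}\rangle\langle\gamma e^{i\theta}|\,d\theta\,d\gamma .$$ Key rounds: $R^z=R([0,\infty),z)$ for $z\in\{0,1,2,3\}$, $G=\mathbb 1_A\otimes\sum_{z=0}^3\sqrt{R^z}\otimes|z\rangle_{\hat Z}$, $\mathcal G(\rho)=G\rho G^\dagger$, and $\mathcal Z(X)=\sum_{j=0}^3(\mathbb 1_{AB}\otimes|j\rangle\langle j|_{\hat Z})\,X\,(\mathbb 1_{AB}\otimes|j\rangle\langle j|_{\hat Z})$. Test rounds: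 let $\delta>0$, $K\in\mathbb N$, $\Delta=K\delta$ and $m=4K+4$; for $z=j+4k$ with $0\le j\le 3$, $0\le k\le K$, let $\tilde R^z=R([\delta k,\delta(k+1)),j)$ if $k<K$ and $\tilde R^z=R([\Delta,\infty),j)$ if $k=K$. Let $\{\Gamma_{x'}\}_{x'=0}^{15}$ be an informationally complete POVM on $A$. Let $p^{\mathrm{key}}>0$ and $p^{\mathrm{PE}},p^{\mathrm{tom}}\ge0$ satisfy $p^{\mathrm{key}}+p^{\mathrm{PE}}+p^{\mathrm{tom}}=1$, and let $\tilde p^{\mathrm{PE}},\tilde p^{\mathrm{tom}}\ge0$ with $\tilde p^{\mathrm{PE}}+\tilde p^{\mathrm{tom}}=1$ be the conditional probabilities of the two kinds of test round, that is $p^{\mathrm{PE}}=(1-p^{\mathrm{key}})\tilde p^{\mathrm{PE}}$ and $p^{\mathrm{tom}}=(1-p^{\mathrm{key}})\tilde p^{\mathrm{tom}}$. Let $\tilde{\mathcal C}=\{(x,z,\perp):0\le x\le3,\ 0\le z<m\}\cup\{(\perp,\perp,x'):0\le x'\le15\}$, and let $\mathcal P_{\tilde{\mathcal C}}$ be the set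 of probability distributions on $\tilde{\mathcal C}$. For $\tilde p\in\mathcal P_{\tilde{\mathcal C}}$ let $\Sigma(\tilde p)$ be the set of density operators $\rho$ on $A\otimes B$ whose test-round statistics are $\tilde p$, that is, $\tilde p^{\mathrm{PE}}\operatorname{Tr}[(|x\rangle\langle x|\otimes\tilde R^z)\rho]=\tilde p(x,z,\perp)$ and $\tilde p^{\mathrm{tom}}\operatorname{Tr}[(\Gamma_{x'}\otimes\mathbb 1_B)\rho]=\tilde p(\perp,\perp,x')$ for all $x,z,x'$. Let $D(\rho\|\sigma)=\frac1{\operatorname{Tr}\rho}\operatorname{Tr}[\rho(\log_2\rho-\log_2\sigma)]$ if $\operatorname{supp}\rho\subseteq\operatorname{supp}\sigma$, and $+\infty$ otherwise. Put $$g(\tilde p)=p^{\mathrm{key}}\min_{\rho\in\Sigma(\tilde p)}D(\mathcal G(\rho)\,\|\,\mathcal Z(\mathcal G(\rho))),\qquad \min\emptyset=+\infty .$$ Then the minimum is attained and finite whenever $\Sigma(\tilde p)\ne\emptyset$, and $g$ is a convex function on $\mathcal P_{\tilde{\mathcal C}}$: for all $p,q\in\mathcal P_{\tilde{\mathcal C}}$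 and $\lambda\in[0,1]$, $g(\lambda p+(1-\lambda)q)\le\lambda g(p)+(1-\lambda)g(q)$ (with $0\cdot\infty=0$). -/

import Mathlib

open scoped Kronecker ComplexOrder

noncomputable section

namespace CVQKD

/-- Alice's system `A` (dimension 4) together with Bob's system `B`, truncated to the `N` lowest
Fock states `|0⟩, …, |N-1⟩`. -/
abbrev AB (N : ℕ) : Type := Fin 4 × Fin N

/-- Density matrices: positive semidefinite of trace one. -/
def IsDensity {ι : Type*} [Fintype ι] (ρ : Matrix ι ι ℂ) : Prop :=
  ρ.PosSemidef ∧ ρ.trace = 1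

open Classical in
/-- Umegaki relative entropy (in bits) of positive semidefinite matrices, normalised by `Tr ρ`:
`D(ρ‖σ) = Tr[ρ (log ρ - log σ)] / Tr ρ` if `supp ρ ⊆ supp σ`, i.e. `ker σ ⊆ ker ρ`, and `+∞`
otherwise. The logarithm is applied by functional calculus with `log 0 = 0`, that is, on the
supports. -/
def relEntropy {ι : Type*} [Fintype ι] [DecidableEq ι] (ρ σ : Matrix ι ι ℂ) : EReal :=
  if ∀ v : ι → ℂ, σ.mulVec v = 0 → ρ.mulVec v = 0 then
    (((ρ.trace.re)⁻¹ *
      (ρ * (cfc (Real.logb 2) ρ - cfc (Real.logb 2) σ)).trace.re : ℝ) : EReal)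
  else ⊤

/-- Fock coefficients `⟨k|α⟩ = exp(-|α|²/2) α^k / √(k!)`, `k < N`, of the coherent state `|α⟩`. -/
def coherentState (N : ℕ) (α : ℂ) : Fin N → ℂ := fun k =>
  (Real.exp (-‖α‖ ^ 2 / 2) : ℂ) * α ^ (k : ℕ) / (Real.sqrt (Nat.factorial k : ℝ) : ℂ)

/-- The operator `(1/π) ∫_{γ ∈ s} ∫_{θ = π(2j-1)/4}^{π(2j+1)/4} γ |γ e^{iθ}⟩⟨γ e^{iθ}| dθ dγ` on the
truncated Fock space, given by its matrix entries. -/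
def regionOp (N : ℕ) (s : Set ℝ) (j : Fin 4) : Matrix (Fin N) (Fin N) ℂ :=
  Matrix.of fun k l =>
    ((1 / Real.pi : ℝ) : ℂ) *
      ∫ γ in s, ∫ θ in (Real.pi / 4 * (2 * (j : ℝ) - 1))..(Real.pi / 4 * (2 * (j : ℝ) + 1)),
        (γ : ℂ) *
          Matrix.vecMulVec
            (coherentState N ((γ : ℂ) * Complex.exp (Complex.I * (θ : ℂ))))
            (star (coherentState N ((γ : ℂ) * Complex.exp (Complex.I * (θ : ℂ))))) k l

/-- Region operators `R^z` of the key rounds: the four quadrants `[π(2z-1)/4, π(2z+1)/4)`. -/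
def keyRegionOp (N : ℕ) (z : Fin 4) : Matrix (Fin N) (Fin N) ℂ :=
  regionOp N (Set.Ici 0) z

/-- Moduli `|y|` of the `k`-th ring of the parameter estimation discretisation with `Δ = K δ`:
`[δ k, δ (k+1))` for `k < K`, and `[Δ, ∞)` for `k = K`. -/
def ringModuli (δ : ℝ) (K k : ℕ) : Set ℝ :=
  if k < K then Set.Ico (δ * k) (δ * (k + 1)) else Set.Ici (K * δ)

/-- Region operators `R̃^z`, `z = j + 4 k`, of the parameter estimation rounds: quadrant `j`,
ring `k`. -/
def peRegionOp (N K : ℕ) (δ : ℝ) (z : Fin (4 * K + 4)) : Matrix (Fin N) (Fin N) ℂ :=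
  regionOp N (ringModuli δ K ((z : ℕ) / 4)) (Fin.ofNat 4 (z : ℕ))

/-- Informationally complete POVM with 16 outcomes on Alice's system. -/
structure IsICPOVM (Γ : Fin 16 → Matrix (Fin 4) (Fin 4) ℂ) : Prop where
  posSemidef : ∀ x, (Γ x).PosSemidef
  sum_eq_one : ∑ x, Γ x = 1
  span_eq_top : Submodule.span ℂ (Set.range Γ) = ⊤

/-- The values of `C = (X̃, Z̃, X')` in test rounds: `(x, z, ⊥)` (parameter estimation) and
`(⊥, ⊥, x')` (tomography). -/
abbrev TestAlphabet (K : ℕ) : Type := (Fin 4 × Fin (4 * K + 4)) ⊕ Fin 16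

/-- The registers `O = (X̃, X', Ẑ, Z̃)`, where `none` stands for `⊥`, and `S = R`. -/
abbrev OS (K : ℕ) : Type :=
  (Option (Fin 4) × Option (Fin 16) × Option (Fin 4) × Option (Fin (4 * K + 4))) × Fin 3

/-- Contents of `O` and `S` in a test round whose statistical value is `c`. -/
def testOS (K : ℕ) : TestAlphabet K → OS K
  | Sum.inl (x, z) => ((some x, none, none, some z), 1)
  | Sum.inr x' => ((none, some x', none, none), 2)

/-- Measurement operators of a test round, which is a parameter estimation round with probability
`qPE` and a tomography round with probability `qTom`. -/
def testEffect (N K : ℕ) (δ : ℝ) (Γ : Fin 16 → Matrix (Fin 4) (Fin 4) ℂ) (qPE qTom : ℝ) :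
    TestAlphabet K → Matrix (AB N) (AB N) ℂ
  | Sum.inl (x, z) => (qPE : ℂ) • (Matrix.single x x (1 : ℂ) ⊗ₖ peRegionOp N K δ z)
  | Sum.inr x' => (qTom : ℂ) • (Γ x' ⊗ₖ (1 : Matrix (Fin N) (Fin N) ℂ))

/-- The test channel `AB → OSC`; all of its output registers are classical. -/
def testChannel (N K : ℕ) (δ : ℝ) (Γ : Fin 16 → Matrix (Fin 4) (Fin 4) ℂ) (qPE qTom : ℝ)
    (ρ : Matrix (AB N) (AB N) ℂ) :
    Matrix (OS K × TestAlphabet K) (OS K × TestAlphabet K) ℂ :=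
  ∑ c : TestAlphabet K,
    (testEffect N K δ Γ qPE qTom c * ρ).trace •
      Matrix.single (testOS K c, c) (testOS K c, c) (1 : ℂ)

/-- Partial trace over the first tensor factor. -/
def traceFst {ι κ : Type*} [Fintype ι] (X : Matrix (ι × κ) (ι × κ) ℂ) : Matrix κ κ ℂ :=
  Matrix.of fun c c' => ∑ i, X (i, c) (i, c')

/-- `Σ(p)`: the states whose test channel output has `C`-marginal with diagonal `p`. -/
def feasible (N K : ℕ) (δ : ℝ) (Γ : Fin 16 → Matrix (Fin 4) (Fin 4) ℂ) (qPE qTom : ℝ)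
    (p : TestAlphabet K → ℝ) : Set (Matrix (AB N) (AB N) ℂ) :=
  {ρ | IsDensity ρ ∧
    ∀ c, traceFst (testChannel N K δ Γ qPE qTom ρ) c c = (p c : ℂ)}

/-- The Kraus operator `G = 1_A ⊗ ∑_z √(R^z) ⊗ |z⟩ : AB → AB Ẑ`. -/
def krausG (N : ℕ) : Matrix (AB N × Fin 4) (AB N) ℂ :=
  ∑ z : Fin 4, Matrix.of fun i j =>
    ((1 : Matrix (Fin 4) (Fin 4) ℂ) ⊗ₖ cfc Real.sqrt (keyRegionOp N z)) i.1 j *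
      (if i.2 = z then 1 else 0)

/-- The map `ρ ↦ G ρ G†`. -/
def mapG (N : ℕ) (ρ : Matrix (AB N) (AB N) ℂ) : Matrix (AB N × Fin 4) (AB N × Fin 4) ℂ :=
  krausG N * ρ * (krausG N).conjTranspose

/-- The pinching of the register `Ẑ`, with Kraus operators `1 ⊗ |j⟩⟨j|`. -/
def pinching (N : ℕ) (X : Matrix (AB N × Fin 4) (AB N × Fin 4) ℂ) :
    Matrix (AB N × Fin 4) (AB N × Fin 4) ℂ :=
  ∑ j : Fin 4,
    ((1 : Matrix (AB N) (AB N) ℂ) ⊗ₖ Matrix.single j j (1 : ℂ)) * X *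
      ((1 : Matrix (AB N) (AB N) ℂ) ⊗ₖ Matrix.single j j (1 : ℂ)).conjTranspose

/-- The objective `ρ ↦ D(𝒢(ρ) ‖ 𝒵(𝒢(ρ)))`. -/
def objective (N : ℕ) (ρ : Matrix (AB N) (AB N) ℂ) : EReal :=
  relEntropy (mapG N ρ) (pinching N (mapG N ρ))

/-- `g(p) = p^key · inf_{ρ ∈ Σ(p)} D(𝒢(ρ) ‖ 𝒵(𝒢(ρ)))`, with `inf ∅ = +∞`. -/
def g (N K : ℕ) (δ : ℝ) (Γ : Fin 16 → Matrix (Fin 4) (Fin 4) ℂ) (qPE qTom pkey : ℝ)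
    (p : TestAlphabet K → ℝ) : EReal :=
  (pkey : EReal) * ⨅ ρ ∈ feasible N K δ Γ qPE qTom p, objective N ρ

end CVQKD

end

/-! The map `ρ ↦ D(𝒢(ρ) ‖ 𝒵(𝒢(ρ)))` is a finite, continuous, convex function on density matrices,
and `Σ(p)` is compact and depends affinely on `p`. Compactness gives a minimiser. A mixture of
minimisers for `p` and `q` is feasible for the mixed statistics, so convexity of the objective
passes to `g`.

Convexity is joint convexity of the relative entropy (`relEnt_add_smul_le`) composed with the linear
maps `𝒢` and `𝒵`. For eigenvalues `p` of `A` and `q` of `B`, `p log p - p log q - p + q` is the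
integral over `t ∈ [0,1]` of `(1-t)(p-q)²/(tp+(1-t)q)`. Summed against the squared eigenvector
overlaps, this writes the relative entropy as a difference of traces plus an integral of quadratic
divergences. Each of these is a maximum over matrices `X` of functionals linear in `(A, B)`, hence
jointly convex.

Finiteness holds because the kernel of a pinched positive matrix lies in the kernel of the matrix
(`ker_pinching_le`). Continuity holds because the relative entropy to the pinching is a difference
of two entropies (`relEnt_pinching`), in which only the continuous function `x log x` occurs. The
key region operators are positive and sum to one, so `G` is an isometry and the normalisation by the
trace is trivial on density matrices. -/

noncomputable section

namespace CVQKD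

/-! ### Joint convexity of the quantum relative entropy -/

section RelativeEntropy

open Matrix

variable {n : Type*} [Fintype n] [DecidableEq n]

/-- The unitary of eigenvectors of a Hermitian matrix, as a matrix. -/
def eigU {A : Matrix n n ℂ} (hA : A.IsHermitian) : Matrix n n ℂ := hA.eigenvectorUnitary

lemma eigU_conjTranspose_mul {A : Matrix n n ℂ} (hA : A.IsHermitian) :
    (eigU hA)ᴴ * eigU hA = 1 :=
  Unitary.coe_star_mul_self hA.eigenvectorUnitary

lemma eigU_mul_conjTranspose {A : Matrix n n ℂ} (hA : A.IsHermitian) :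
    eigU hA * (eigU hA)ᴴ = 1 :=
  Unitary.coe_mul_star_self hA.eigenvectorUnitary

lemma cfc_eq_eigU {A : Matrix n n ℂ} (hA : A.IsHermitian) (f : ℝ → ℝ) :
    cfc f A = eigU hA * diagonal (fun i => (f (hA.eigenvalues i) : ℂ)) * (eigU hA)ᴴ := by
  rw [hA.cfc_eq f, IsHermitian.cfc, Unitary.conjStarAlgAut_apply]
  rfl

lemma eq_eigU {A : Matrix n n ℂ} (hA : A.IsHermitian) :
    A = eigU hA * diagonal (fun i => (hA.eigenvalues i : ℂ)) * (eigU hA)ᴴ := by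
  conv_lhs => rw [← cfc_id ℝ A hA.isSelfAdjoint]
  exact cfc_eq_eigU hA id

lemma eigU_conjTranspose_mul_self {A : Matrix n n ℂ} (hA : A.IsHermitian) :
    (eigU hA)ᴴ * A = diagonal (fun i => (hA.eigenvalues i : ℂ)) * (eigU hA)ᴴ := by
  have h := congrArg (fun M => (eigU hA)ᴴ * M) (eq_eigU hA)
  simp only [← Matrix.mul_assoc, eigU_conjTranspose_mul, Matrix.one_mul] at h
  exact h

/-- The overlaps of the eigenvectors of two Hermitian matrices. -/
def overlap {A B : Matrix n n ℂ} (hA : A.IsHermitian) (hB : B.IsHermitian) : Matrix n n ℂ :=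
  (eigU hA)ᴴ * eigU hB

/-- Each factor is diagonal in its own eigenbasis, and only the moduli of the overlaps survive in
the trace. Identities between two noncommuting matrices thus reduce to scalar identities for pairs
of eigenvalues. -/
lemma trace_cfc_mul_cfc {A B : Matrix n n ℂ} (hA : A.IsHermitian) (hB : B.IsHermitian)
    (f g : ℝ → ℝ) :
    (cfc f A * cfc g B).trace =
      ((∑ i, ∑ j, ‖overlap hA hB i j‖ ^ 2 * (f (hA.eigenvalues i) * g (hB.eigenvalues j)) : ℝ) :
        ℂ) := by
  have h : (cfc f A * cfc g B).trace =
      (diagonal (fun i => (f (hA.eigenvalues i) : ℂ)) * overlap hA hB *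
        diagonal (fun i => (g (hB.eigenvalues i) : ℂ)) * (overlap hA hB)ᴴ).trace := by
    rw [cfc_eq_eigU hA, cfc_eq_eigU hB, overlap, conjTranspose_mul, conjTranspose_conjTranspose]
    simp only [Matrix.mul_assoc]
    rw [trace_mul_comm]
    simp only [Matrix.mul_assoc]
  rw [h, trace]
  push_cast
  refine Finset.sum_congr rfl fun i _ => ?_
  rw [diag_apply, mul_apply]
  refine Finset.sum_congr rfl fun j _ => ?_
  rw [mul_diagonal, diagonal_mul, conjTranspose_apply, ← Complex.ofReal_pow,
    ← Complex.normSq_eq_norm_sq, ← Complex.mul_conj, ← starRingEnd_apply]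
  ring

/-- The weighted quadratic divergence in the integral representation of the relative entropy. -/
def quadDiv {A B : Matrix n n ℂ} (hA : A.IsHermitian) (hB : B.IsHermitian) (t : ℝ) : ℝ :=
  ∑ i, ∑ j, ‖overlap hA hB i j‖ ^ 2 * ((hA.eigenvalues i - hB.eigenvalues j) ^ 2 /
    (t * hA.eigenvalues i + (1 - t) * hB.eigenvalues j))

/-- The functional, affine in `(A, B)`, whose supremum over `X` is `quadDiv`. -/
def quadFun (t : ℝ) (X A B : Matrix n n ℂ) : ℝ :=
  2 * (Xᴴ * (A - B)).trace.re - t * (Xᴴ * A * X).trace.re - (1 - t) * (X * B * Xᴴ).trace.re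

lemma quadFun_add_smul (t : ℝ) (X A₁ A₂ B₁ B₂ : Matrix n n ℂ) (a b : ℝ) :
    quadFun t X (a • A₁ + b • A₂) (a • B₁ + b • B₂) =
      a * quadFun t X A₁ B₁ + b * quadFun t X A₂ B₂ := by
  simp only [quadFun, mul_add, mul_sub, add_mul, trace_add, trace_sub, Matrix.mul_smul,
    Matrix.smul_mul, trace_smul, Complex.add_re, Complex.sub_re, Complex.smul_re, smul_eq_mul]
  ring

/-- In coordinates with rows along the eigenvectors of `A` and columns along those of `B`, the
functional decouples into one scalar quadratic for each entry of `k`, so it can be maximised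
entrywise. -/
lemma quadFun_conj {A B : Matrix n n ℂ} (hA : A.IsHermitian) (hB : B.IsHermitian) (t : ℝ)
    (k : Matrix n n ℂ) :
    quadFun t (eigU hA * k * (eigU hB)ᴴ) A B =
      ∑ i, ∑ j, (2 * (hA.eigenvalues i - hB.eigenvalues j) *
          (star (k i j) * overlap hA hB i j).re -
        (t * hA.eigenvalues i + (1 - t) * hB.eigenvalues j) * ‖k i j‖ ^ 2) := by
  set U := eigU hA with hU
  set V := eigU hB with hV
  set P : Matrix n n ℂ := diagonal (fun i => (hA.eigenvalues i : ℂ)) with hP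
  set Q : Matrix n n ℂ := diagonal (fun i => (hB.eigenvalues i : ℂ)) with hQ
  have eA : A = U * P * Uᴴ := eq_eigU hA
  have eB : B = V * Q * Vᴴ := eq_eigU hB
  have UU : Uᴴ * U = 1 := eigU_conjTranspose_mul hA
  have VV : Vᴴ * V = 1 := eigU_conjTranspose_mul hB
  have UU' (M : Matrix n n ℂ) : Uᴴ * (U * M) = M := by rw [← Matrix.mul_assoc, UU, Matrix.one_mul]
  have VV' (M : Matrix n n ℂ) : Vᴴ * (V * M) = M := by rw [← Matrix.mul_assoc, VV, Matrix.one_mul]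
  have h1 : ((U * k * Vᴴ)ᴴ * (A - B)).trace =
      (kᴴ * (P * overlap hA hB - overlap hA hB * Q)).trace := by
    rw [show overlap hA hB = Uᴴ * V from rfl, eA, eB]
    simp only [conjTranspose_mul, conjTranspose_conjTranspose, mul_sub, trace_sub,
      Matrix.mul_assoc, UU']
    rw [trace_mul_comm V, trace_mul_comm V]
    simp only [Matrix.mul_assoc, VV, Matrix.mul_one]
  have h2 : ((U * k * Vᴴ)ᴴ * A * (U * k * Vᴴ)).trace = (kᴴ * P * k).trace := by
    rw [eA]
    simp only [conjTranspose_mul, conjTranspose_conjTranspose, Matrix.mul_assoc, UU']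
    rw [trace_mul_comm V]
    simp only [Matrix.mul_assoc, VV, Matrix.mul_one]
  have h3 : ((U * k * Vᴴ) * B * (U * k * Vᴴ)ᴴ).trace = (k * Q * kᴴ).trace := by
    rw [eB]
    simp only [conjTranspose_mul, conjTranspose_conjTranspose, Matrix.mul_assoc, VV']
    rw [trace_mul_comm U]
    simp only [Matrix.mul_assoc, UU, Matrix.mul_one]
  have hn (z : ℂ) : ((‖z‖ ^ 2 : ℝ) : ℂ) = star z * z := by
    rw [← Complex.normSq_eq_norm_sq, Complex.normSq_eq_conj_mul_self]; rfl
  have e1 : (kᴴ * (P * overlap hA hB - overlap hA hB * Q)).trace.re = ∑ i, ∑ j,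
      (hA.eigenvalues i - hB.eigenvalues j) * (star (k i j) * overlap hA hB i j).re := by
    rw [trace, Finset.sum_comm, Complex.re_sum]
    refine Finset.sum_congr rfl fun j _ => ?_
    rw [diag_apply, mul_apply, Complex.re_sum]
    refine Finset.sum_congr rfl fun i _ => ?_
    rw [Matrix.sub_apply, hP, hQ, mul_diagonal, diagonal_mul, conjTranspose_apply,
      ← Complex.re_ofReal_mul]
    congr 1
    push_cast
    ring
  have e2 : (kᴴ * P * k).trace.re = ∑ i, ∑ j, hA.eigenvalues i * ‖k i j‖ ^ 2 := by
    rw [trace, Finset.sum_comm, Complex.re_sum]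
    refine Finset.sum_congr rfl fun j _ => ?_
    rw [diag_apply, mul_apply, Complex.re_sum]
    refine Finset.sum_congr rfl fun i _ => ?_
    rw [hP, mul_diagonal, conjTranspose_apply, ← Complex.ofReal_re (_ * _)]
    congr 1
    rw [Complex.ofReal_mul, hn]
    ring
  have e3 : (k * Q * kᴴ).trace.re = ∑ i, ∑ j, hB.eigenvalues j * ‖k i j‖ ^ 2 := by
    rw [trace, Complex.re_sum]
    refine Finset.sum_congr rfl fun j _ => ?_
    rw [diag_apply, mul_apply, Complex.re_sum]
    refine Finset.sum_congr rfl fun i _ => ?_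
    rw [hQ, mul_diagonal, conjTranspose_apply, ← Complex.ofReal_re (_ * _)]
    congr 1
    rw [Complex.ofReal_mul, hn]
    ring
  rw [quadFun, h1, h2, h3, e1, e2, e3, Finset.mul_sum, Finset.mul_sum, Finset.mul_sum,
    ← Finset.sum_sub_distrib, ← Finset.sum_sub_distrib]
  refine Finset.sum_congr rfl fun i _ => ?_
  rw [Finset.mul_sum, Finset.mul_sum, Finset.mul_sum,
    ← Finset.sum_sub_distrib, ← Finset.sum_sub_distrib]
  refine Finset.sum_congr rfl fun j _ => ?_
  ring

lemma quadFun_le_quadDiv {A B : Matrix n n ℂ} (hA : A.PosSemidef) (hB : B.PosSemidef) {t : ℝ}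
    (h0 : 0 < t) (h1 : t < 1) (X : Matrix n n ℂ) :
    quadFun t X A B ≤ quadDiv hA.1 hB.1 t := by
  have hX : X = eigU hA.1 * ((eigU hA.1)ᴴ * X * eigU hB.1) * (eigU hB.1)ᴴ := by
    simp only [Matrix.mul_assoc, eigU_mul_conjTranspose, Matrix.mul_one]
    rw [← Matrix.mul_assoc, eigU_mul_conjTranspose, Matrix.one_mul]
  rw [hX, quadFun_conj, quadDiv]
  refine Finset.sum_le_sum fun i _ => Finset.sum_le_sum fun j _ => ?_
  set k := ((eigU hA.1)ᴴ * X * eigU hB.1) i j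
  set W := overlap hA.1 hB.1 i j
  have hp := hA.eigenvalues_nonneg i
  have hq := hB.eigenvalues_nonneg j
  set p := hA.1.eigenvalues i
  set q := hB.1.eigenvalues j
  have hw : 0 ≤ t * p + (1 - t) * q := by nlinarith [mul_nonneg h0.le hp, mul_nonneg (sub_nonneg.2 h1.le) hq]
  rcases hw.eq_or_lt with hw | hw
  · have hp0 : p = 0 := by
      by_contra h
      have := mul_pos h0 (hp.lt_of_ne' h)
      nlinarith [mul_nonneg (sub_nonneg.2 h1.le) hq]
    have hq0 : q = 0 := by
      by_contra h
      have := mul_pos (sub_pos.2 h1) (hq.lt_of_ne' h)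
      nlinarith [mul_nonneg h0.le hp]
    simp [hp0, hq0]
  -- Completing the square: after multiplication by the denominator `w = tp + (1-t)q`, the claim is
  -- `0 ≤ ‖(p-q)W - wk‖²`.
  · have hz := Complex.sq_norm ((((p - q) : ℝ) : ℂ) * W - ((t * p + (1 - t) * q : ℝ) : ℂ) * k)
    have hpos := sq_nonneg ‖(((p - q) : ℝ) : ℂ) * W - ((t * p + (1 - t) * q : ℝ) : ℂ) * k‖
    rw [hz] at hpos
    rw [← mul_div_assoc, le_div_iff₀ hw, Complex.sq_norm, Complex.sq_norm]
    simp only [Complex.normSq_apply, Complex.sub_re, Complex.sub_im, Complex.ofReal_re,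
      Complex.ofReal_im, Complex.mul_re, Complex.mul_im, zero_mul, sub_zero, add_zero, RCLike.star_def, Complex.conj_re, Complex.conj_im] at hpos ⊢
    linarith

lemma exists_quadFun_eq_quadDiv {A B : Matrix n n ℂ} (hA : A.IsHermitian) (hB : B.IsHermitian)
    (t : ℝ) : ∃ X : Matrix n n ℂ, quadFun t X A B = quadDiv hA hB t := by
  -- The witness is the stationary point `(p-q)W/w` of each scalar quadratic. Where `w = 0`,
  -- division by zero makes both this entry and the term of `quadDiv` vanish.
  refine ⟨eigU hA * Matrix.of (fun i j => (((hA.eigenvalues i - hB.eigenvalues j) /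
    (t * hA.eigenvalues i + (1 - t) * hB.eigenvalues j) : ℝ) : ℂ) * overlap hA hB i j) *
      (eigU hB)ᴴ, ?_⟩
  rw [quadFun_conj, quadDiv]
  refine Finset.sum_congr rfl fun i _ => Finset.sum_congr rfl fun j _ => ?_
  rw [of_apply, Complex.sq_norm, Complex.sq_norm]
  set W := overlap hA hB i j
  set w := t * hA.eigenvalues i + (1 - t) * hB.eigenvalues j
  set d := hA.eigenvalues i - hB.eigenvalues j
  simp only [Complex.normSq_apply, Complex.ofReal_re,
      Complex.ofReal_im, Complex.mul_re, Complex.mul_im, zero_mul, sub_zero, add_zero, RCLike.star_def, Complex.conj_re, Complex.conj_im]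
  by_cases hw : w = 0
  · simp [hw]
  · field_simp
    ring

lemma quadDiv_add_smul_le {A₁ A₂ B₁ B₂ : Matrix n n ℂ} (hA₁ : A₁.PosSemidef)
    (hA₂ : A₂.PosSemidef) (hB₁ : B₁.PosSemidef) (hB₂ : B₂.PosSemidef) {a b : ℝ} (ha : 0 ≤ a)
    (hb : 0 ≤ b) (hA : (a • A₁ + b • A₂).IsHermitian) (hB : (a • B₁ + b • B₂).IsHermitian) {t : ℝ}
    (h0 : 0 < t) (h1 : t < 1) :
    quadDiv hA hB t ≤ a * quadDiv hA₁.1 hB₁.1 t + b * quadDiv hA₂.1 hB₂.1 t := by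
  obtain ⟨X, hX⟩ := exists_quadFun_eq_quadDiv hA hB t
  rw [← hX, quadFun_add_smul]
  gcongr
  · exact quadFun_le_quadDiv hA₁ hB₁ h0 h1 X
  · exact quadFun_le_quadDiv hA₂ hB₂ h0 h1 X

/-- An antiderivative is `p log(tp+(1-t)q) - (p-q)t`. Nonnegativity of its derivative gives
integrability without an estimate at the endpoints. -/
lemma scalar_integral {p q : ℝ} (hp : 0 ≤ p) (hq : 0 < q) :
    IntervalIntegrable (fun t => (1 - t) * ((p - q) ^ 2 / (t * p + (1 - t) * q)))
        MeasureTheory.volume 0 1 ∧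
      ∫ t in (0 : ℝ)..1, (1 - t) * ((p - q) ^ 2 / (t * p + (1 - t) * q)) =
        p * Real.log p - p * Real.log q - p + q := by
  have hw : ∀ t ∈ Set.Ioo (0 : ℝ) 1, 0 < t * p + (1 - t) * q := fun t ht => by
    nlinarith [mul_nonneg ht.1.le hp, mul_pos (sub_pos.2 ht.2) hq]
  have hc : ContinuousOn (fun t => p * Real.log (t * p + (1 - t) * q) - (p - q) * t)
      (Set.Icc 0 1) := by
    -- For `p = 0` the logarithm is singular at `t = 1`, but its coefficient vanishes.
    rcases hp.eq_or_lt with rfl | hp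
    · simp only [zero_mul]
      fun_prop
    · refine ContinuousOn.sub (continuousOn_const.mul (ContinuousOn.log (by fun_prop) ?_))
        (by fun_prop)
      intro t ht
      have h1 := mul_nonneg ht.1 hp.le
      have h2 := mul_nonneg (sub_nonneg.2 ht.2) hq.le
      rcases ht.1.eq_or_lt with rfl | h
      · simpa using hq.ne'
      · have := mul_pos h hp
        positivity
  have hd : ∀ t ∈ Set.Ioo (0 : ℝ) 1,
      HasDerivAt (fun t => p * Real.log (t * p + (1 - t) * q) - (p - q) * t)
        ((1 - t) * ((p - q) ^ 2 / (t * p + (1 - t) * q))) t := by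
    intro t ht
    have h1 : HasDerivAt (fun t : ℝ => t * p + (1 - t) * q) (1 * p + (-1) * q) t :=
      ((hasDerivAt_id t).mul_const p).add (((hasDerivAt_id t).const_sub 1).mul_const q)
    convert! ((h1.log (hw t ht).ne').const_mul p).sub ((hasDerivAt_id t).const_mul (p - q)) using 1
    have := (hw t ht).ne'
    field_simp
    ring
  have hi : IntervalIntegrable (fun t => (1 - t) * ((p - q) ^ 2 / (t * p + (1 - t) * q)))
        MeasureTheory.volume 0 1 := by
    refine intervalIntegral.intervalIntegrable_deriv_of_nonneg
      (by rwa [Set.uIcc_of_le zero_le_one]) ?_ ?_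
    · simpa using hd
    · intro t ht
      simp only [zero_le_one, inf_of_le_left, sup_of_le_right] at ht
      have := hw t ht
      have := sub_pos.2 ht.2
      positivity
  refine ⟨hi, ?_⟩
  rw [intervalIntegral.integral_eq_sub_of_hasDerivAt_of_le zero_le_one hc hd hi]
  simp
  ring

/-- An eigenvector in the kernel of `B` is also in the kernel of `A`, hence orthogonal to the
eigenvectors of `A` with nonzero eigenvalue. This removes the terms in which the relative entropy
would be infinite. -/
lemma overlap_eq_zero {A B : Matrix n n ℂ} (hA : A.IsHermitian) (hB : B.IsHermitian)
    (hker : ∀ v, B *ᵥ v = 0 → A *ᵥ v = 0) {i j : n} (hj : hB.eigenvalues j = 0)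
    (hi : hA.eigenvalues i ≠ 0) : overlap hA hB i j = 0 := by
  have hv : B *ᵥ ((eigU hB) *ᵥ Pi.single j 1) = 0 := by
    conv_lhs => enter [1]; rw [eq_eigU hB]
    rw [mulVec_mulVec, Matrix.mul_assoc, eigU_conjTranspose_mul, Matrix.mul_one, ← mulVec_mulVec,
      diagonal_mulVec_single, hj]
    simp
  have h := hker _ hv
  have h2 : ((eigU hA)ᴴ *ᵥ (A *ᵥ ((eigU hB) *ᵥ Pi.single j 1))) i =
      hA.eigenvalues i * overlap hA hB i j := by
    rw [mulVec_mulVec, mulVec_mulVec, eigU_conjTranspose_mul_self,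
      Matrix.mul_assoc (diagonal _), ← overlap, mulVec_single_one, col_apply, diagonal_mul]
  rw [h, mulVec_zero, Pi.zero_apply, eq_comm, mul_eq_zero] at h2
  exact h2.resolve_left (by exact_mod_cast hi)

/-- Real value of the unnormalised relative entropy, in bits. -/
def relEnt (A B : Matrix n n ℂ) : ℝ :=
  (A * (cfc (Real.logb 2) A - cfc (Real.logb 2) B)).trace.re

lemma relEnt_eq_sum {A B : Matrix n n ℂ} (hA : A.IsHermitian) (hB : B.IsHermitian) :
    relEnt A B = ∑ i, ∑ j, ‖overlap hA hB i j‖ ^ 2 *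
      (hA.eigenvalues i * Real.logb 2 (hA.eigenvalues i) -
        hA.eigenvalues i * Real.logb 2 (hB.eigenvalues j)) := by
  have hc (f : ℝ → ℝ) : ContinuousOn f (spectrum ℝ A) :=
    (Matrix.finite_real_spectrum (A := A)).continuousOn f
  have h1 : A * cfc (Real.logb 2) A =
      cfc (fun x => x * Real.logb 2 x) A * cfc (fun _ : ℝ => (1 : ℝ)) B := by
    rw [cfc_const_one ℝ B, mul_one, cfc_mul _ _ A (hc _) (hc _), cfc_id' ℝ A]
  have h2 : A * cfc (Real.logb 2) B = cfc (fun x : ℝ => x) A * cfc (Real.logb 2) B := by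
    rw [cfc_id' ℝ A]
  rw [relEnt, mul_sub, h1, h2, trace_sub, trace_cfc_mul_cfc hA hB, trace_cfc_mul_cfc hA hB,
    ← Complex.ofReal_sub, Complex.ofReal_re, ← Finset.sum_sub_distrib]
  refine Finset.sum_congr rfl fun i _ => ?_
  rw [← Finset.sum_sub_distrib]
  refine Finset.sum_congr rfl fun j _ => ?_
  ring

/-- Inserting the identity as a constant function of the other matrix gives the traces the same
overlap weights as `relEnt_eq_sum`, so the two sums can be compared term by term. -/
lemma trace_sub_trace_eq_sum {A B : Matrix n n ℂ} (hA : A.IsHermitian) (hB : B.IsHermitian) :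
    A.trace.re - B.trace.re = ∑ i, ∑ j, ‖overlap hA hB i j‖ ^ 2 *
      (hA.eigenvalues i - hB.eigenvalues j) := by
  have h1 : A = cfc (fun x : ℝ => x) A * cfc (fun _ : ℝ => (1 : ℝ)) B := by
    rw [cfc_const_one ℝ B, mul_one, cfc_id' ℝ A]
  have h2 : B = cfc (fun _ : ℝ => (1 : ℝ)) A * cfc (fun x : ℝ => x) B := by
    rw [cfc_const_one ℝ A, one_mul, cfc_id' ℝ B]
  have e1 : A.trace.re = _ := congrArg (fun M => M.trace.re) h1
  have e2 : B.trace.re = _ := congrArg (fun M => M.trace.re) h2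
  rw [trace_cfc_mul_cfc hA hB, Complex.ofReal_re] at e1 e2
  rw [e1, e2, ← Finset.sum_sub_distrib]
  refine Finset.sum_congr rfl fun i _ => ?_
  rw [← Finset.sum_sub_distrib]
  refine Finset.sum_congr rfl fun j _ => ?_
  ring

lemma intervalIntegrable_finset_sum {ι : Type*} (s : Finset ι) {f : ι → ℝ → ℝ} {a b : ℝ}
    (h : ∀ i ∈ s, IntervalIntegrable (f i) MeasureTheory.volume a b) :
    IntervalIntegrable (fun t => ∑ i ∈ s, f i t) MeasureTheory.volume a b := by
  simpa only [Finset.sum_fn] using IntervalIntegrable.sum s h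

lemma relEnt_eq_integral {A B : Matrix n n ℂ} (hA : A.PosSemidef) (hB : B.PosSemidef)
    (hker : ∀ v, B *ᵥ v = 0 → A *ᵥ v = 0) :
    IntervalIntegrable (fun t => (1 - t) * quadDiv hA.1 hB.1 t) MeasureTheory.volume 0 1 ∧
      Real.log 2 * relEnt A B = A.trace.re - B.trace.re +
        ∫ t in (0 : ℝ)..1, (1 - t) * quadDiv hA.1 hB.1 t := by
  have key (i j : n) : IntervalIntegrable (fun t => ‖overlap hA.1 hB.1 i j‖ ^ 2 * ((1 - t) *
        ((hA.1.eigenvalues i - hB.1.eigenvalues j) ^ 2 /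
          (t * hA.1.eigenvalues i + (1 - t) * hB.1.eigenvalues j)))) MeasureTheory.volume 0 1 ∧
      ∫ t in (0 : ℝ)..1, ‖overlap hA.1 hB.1 i j‖ ^ 2 * ((1 - t) *
        ((hA.1.eigenvalues i - hB.1.eigenvalues j) ^ 2 /
          (t * hA.1.eigenvalues i + (1 - t) * hB.1.eigenvalues j))) =
      ‖overlap hA.1 hB.1 i j‖ ^ 2 *
        (hA.1.eigenvalues i * Real.log (hA.1.eigenvalues i) -
          hA.1.eigenvalues i * Real.log (hB.1.eigenvalues j) -
            hA.1.eigenvalues i + hB.1.eigenvalues j) := by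
    -- If `q = 0`, either `p = 0` and everything vanishes, with `0/0 = 0` and `log 0 = 0`, or the
    -- overlap vanishes by the kernel condition.
    rcases (hB.eigenvalues_nonneg j).eq_or_lt with hj | hj
    · by_cases hi : hA.1.eigenvalues i = 0
      · simp [hi, ← hj]
      · simp [overlap_eq_zero hA.1 hB.1 hker hj.symm hi]
    · obtain ⟨h1, h2⟩ := scalar_integral (hA.eigenvalues_nonneg i) hj
      exact ⟨h1.const_mul _, by rw [intervalIntegral.integral_const_mul, h2]⟩
  have hq (t : ℝ) : (1 - t) * quadDiv hA.1 hB.1 t = ∑ i, ∑ j, ‖overlap hA.1 hB.1 i j‖ ^ 2 *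
      ((1 - t) * ((hA.1.eigenvalues i - hB.1.eigenvalues j) ^ 2 /
          (t * hA.1.eigenvalues i + (1 - t) * hB.1.eigenvalues j))) := by
    simp only [quadDiv, Finset.mul_sum]
    exact Finset.sum_congr rfl fun i _ => Finset.sum_congr rfl fun j _ => by ring
  simp only [hq]
  have hint (i : n) := intervalIntegrable_finset_sum Finset.univ fun j _ => (key i j).1
  have hint2 := intervalIntegrable_finset_sum Finset.univ fun i _ => hint i
  refine ⟨hint2, ?_⟩
  rw [trace_sub_trace_eq_sum hA.1 hB.1, relEnt_eq_sum hA.1 hB.1,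
    intervalIntegral.integral_finsetSum fun i _ => hint i, Finset.mul_sum,
    ← Finset.sum_add_distrib]
  refine Finset.sum_congr rfl fun i _ => ?_
  rw [intervalIntegral.integral_finsetSum fun j _ => (key i j).1, Finset.mul_sum,
    ← Finset.sum_add_distrib]
  refine Finset.sum_congr rfl fun j _ => ?_
  rw [(key i j).2, Real.logb, Real.logb]
  have := (Real.log_pos one_lt_two).ne'
  field_simp
  ring

/-- Joint convexity of the relative entropy. -/
theorem relEnt_add_smul_le {A₁ A₂ B₁ B₂ : Matrix n n ℂ} (hA₁ : A₁.PosSemidef)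
    (hA₂ : A₂.PosSemidef) (hB₁ : B₁.PosSemidef) (hB₂ : B₂.PosSemidef) {a b : ℝ} (ha : 0 ≤ a)
    (hb : 0 ≤ b) (hA : (a • A₁ + b • A₂).PosSemidef) (hB : (a • B₁ + b • B₂).PosSemidef)
    (h₁ : ∀ v, B₁ *ᵥ v = 0 → A₁ *ᵥ v = 0) (h₂ : ∀ v, B₂ *ᵥ v = 0 → A₂ *ᵥ v = 0)
    (h : ∀ v, (a • B₁ + b • B₂) *ᵥ v = 0 → (a • A₁ + b • A₂) *ᵥ v = 0) :
    relEnt (a • A₁ + b • A₂) (a • B₁ + b • B₂) ≤ a * relEnt A₁ B₁ + b * relEnt A₂ B₂ := by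
  obtain ⟨i₁, e₁⟩ := relEnt_eq_integral hA₁ hB₁ h₁
  obtain ⟨i₂, e₂⟩ := relEnt_eq_integral hA₂ hB₂ h₂
  obtain ⟨i, e⟩ := relEnt_eq_integral hA hB h
  -- The trace terms are linear in the pair, so only the integrals need comparing; the weight `1 -
  -- t` is nonnegative.
  have hle : ∫ t in (0 : ℝ)..1, (1 - t) * quadDiv hA.1 hB.1 t ≤
      ∫ t in (0 : ℝ)..1, (a * ((1 - t) * quadDiv hA₁.1 hB₁.1 t) +
        b * ((1 - t) * quadDiv hA₂.1 hB₂.1 t)) := by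
    refine intervalIntegral.integral_mono_on_of_le_Ioo zero_le_one i
      ((i₁.const_mul a).add (i₂.const_mul b)) fun t ht => ?_
    have := mul_le_mul_of_nonneg_left
      (quadDiv_add_smul_le hA₁ hA₂ hB₁ hB₂ ha hb hA.1 hB.1 ht.1 ht.2) (sub_nonneg.2 ht.2.le)
    linarith
  rw [intervalIntegral.integral_add (i₁.const_mul a) (i₂.const_mul b),
    intervalIntegral.integral_const_mul, intervalIntegral.integral_const_mul] at hle
  simp only [trace_add, trace_smul, Complex.add_re, Complex.smul_re, smul_eq_mul] at e
  refine le_of_mul_le_mul_left ?_ (Real.log_pos one_lt_two)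
  rw [e, mul_add, mul_left_comm, e₁, mul_left_comm, e₂]
  linarith

end RelativeEntropy

/-! ### Positivity and completeness of the key region operators -/

section RegionOperators

open Matrix MeasureTheory

/-- The quadratic form of an entrywise integral is the integral of the quadratic forms. -/
lemma posSemidef_integral {n X : Type*} [Fintype n] [MeasurableSpace X] {μ : Measure X}
    {A : X → Matrix n n ℂ} (hA : ∀ᵐ x ∂μ, (A x).PosSemidef)
    (hi : ∀ i j, Integrable (fun x => A x i j) μ) :
    (Matrix.of fun i j => ∫ x, A x i j ∂μ).PosSemidef := by
  refine PosSemidef.of_dotProduct_mulVec_nonneg ?_ fun v => ?_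
  · ext i j
    rw [conjTranspose_apply, of_apply, of_apply, RCLike.star_def, ← integral_conj]
    refine integral_congr_ae (hA.mono fun x hx => ?_)
    have := congrFun (congrFun hx.1 i) j
    rwa [conjTranspose_apply] at this
  · have h : star v ⬝ᵥ ((Matrix.of fun i j => ∫ x, A x i j ∂μ) *ᵥ v) =
        ∫ x, star v ⬝ᵥ (A x *ᵥ v) ∂μ := by
      simp only [dotProduct, mulVec, of_apply]
      rw [integral_finsetSum]
      · refine Finset.sum_congr rfl fun i _ => ?_
        rw [integral_const_mul, integral_finsetSum]
        · simp only [integral_mul_const]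
        · exact fun j _ => (hi i j).mul_const _
      · exact fun i _ => (integrable_finsetSum _ fun j _ => (hi i j).mul_const _).const_mul _
    rw [h]
    exact integral_nonneg_of_ae (hA.mono fun x hx => hx.dotProduct_mulVec_nonneg v)

/-- Radial factor of the entries of `γ |γ e^{iθ}⟩⟨γ e^{iθ}|`. -/
def radial (k l : ℕ) (γ : ℝ) : ℝ :=
  (Real.sqrt k.factorial * Real.sqrt l.factorial)⁻¹ *
    (γ ^ ((k : ℝ) + l + 1) * Real.exp (-1 * γ ^ (2 : ℝ)))

/-- Separation into a radial and an angular factor turns the double integral into a product. The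
radial factor uses real exponents to match the Gamma integral, whence the need for `0 < γ`. -/
lemma coherent_entry (N : ℕ) {γ : ℝ} (hγ : 0 < γ) (θ : ℝ) (k l : Fin N) :
    (γ : ℂ) * vecMulVec (coherentState N ((γ : ℂ) * Complex.exp (Complex.I * (θ : ℂ))))
      (star (coherentState N ((γ : ℂ) * Complex.exp (Complex.I * (θ : ℂ))))) k l =
      (radial k l γ : ℂ) * Complex.exp (Complex.I * ((k : ℕ) - (l : ℕ) : ℂ) * θ) := by
  have hnorm : ‖(γ : ℂ) * Complex.exp (Complex.I * (θ : ℂ))‖ = γ := by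
    rw [norm_mul, mul_comm Complex.I, Complex.norm_exp_ofReal_mul_I, Complex.norm_real, mul_one,
      Real.norm_of_nonneg hγ.le]
  have hr : radial k l γ = (Real.sqrt (k : ℕ).factorial * Real.sqrt (l : ℕ).factorial)⁻¹ *
      (γ ^ (k : ℕ) * γ ^ (l : ℕ) * γ *
        (Real.exp (-γ ^ 2 / 2) * Real.exp (-γ ^ 2 / 2))) := by
    rw [radial, Real.rpow_add hγ, Real.rpow_add hγ, Real.rpow_natCast, Real.rpow_natCast,
      Real.rpow_one, ← Real.exp_add, Real.rpow_two]
    ring_nf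
  have he : Complex.exp (Complex.I * ((k : ℕ) - (l : ℕ) : ℂ) * θ) =
      Complex.exp (Complex.I * θ) ^ (k : ℕ) * star (Complex.exp (Complex.I * θ)) ^ (l : ℕ) := by
    rw [RCLike.star_def, ← Complex.exp_conj, ← Complex.exp_nat_mul, ← Complex.exp_nat_mul,
      ← Complex.exp_add]
    congr 1
    simp
    ring
  rw [vecMulVec_apply, Pi.star_apply, coherentState, coherentState, hnorm, hr, he]
  simp only [star_div₀, star_mul', star_pow, RCLike.star_def, Complex.conj_ofReal]
  push_cast
  have h1 : ((Real.sqrt (k : ℕ).factorial : ℝ) : ℂ) ≠ 0 := by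
    exact_mod_cast (Real.sqrt_pos.2 (by positivity)).ne'
  have h2 : ((Real.sqrt (l : ℕ).factorial : ℝ) : ℂ) ≠ 0 := by
    exact_mod_cast (Real.sqrt_pos.2 (by positivity)).ne'
  field_simp
  rw [mul_pow, mul_pow]
  ring

lemma integrableOn_radial (k l : ℕ) : IntegrableOn (radial k l) (Set.Ioi 0) := by
  refine Integrable.const_mul ?_ _
  exact integrableOn_rpow_mul_exp_neg_mul_rpow (by linarith [k.cast_nonneg (α := ℝ), l.cast_nonneg (α := ℝ)])
    two_pos one_pos

lemma integral_radial_self (k : ℕ) : ∫ γ in Set.Ioi (0 : ℝ), radial k k γ = 1 / 2 := by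
  unfold radial
  rw [integral_const_mul, integral_rpow_mul_exp_neg_mul_rpow two_pos
    (by linarith [k.cast_nonneg (α := ℝ)]) one_pos, Real.one_rpow,
    show ((k : ℝ) + k + 1 + 1) / 2 = k + 1 by ring, Real.Gamma_nat_eq_factorial,
    Real.mul_self_sqrt (by positivity)]
  have : (k.factorial : ℝ) ≠ 0 := by positivity
  field_simp

/-- Angular factor of the entries of the region operators. -/
def angular (k l : ℕ) (j : Fin 4) : ℂ :=
  ∫ θ in (Real.pi / 4 * (2 * (j : ℝ) - 1))..(Real.pi / 4 * (2 * (j : ℝ) + 1)),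
    Complex.exp (Complex.I * ((k : ℂ) - (l : ℂ)) * (θ : ℝ))

lemma sum_angular (k l : ℕ) : ∑ j, angular k l j = if k = l then (2 * Real.pi : ℂ) else 0 := by
  split_ifs with h
  · subst h
    simp [angular, Fin.sum_univ_four]
    ring
  · have hc : Complex.I * ((k : ℂ) - (l : ℂ)) ≠ 0 :=
      mul_ne_zero Complex.I_ne_zero (sub_ne_zero.2 (by exact_mod_cast h))
    -- The four sectors tile `[-π/4, 7π/4]`, so the sum telescopes to the outer endpoints, which
    -- differ by a full turn.
    have hp : Complex.exp (Complex.I * ((k : ℂ) - (l : ℂ)) *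
          ((Real.pi / 4 * (2 * ((3 : Fin 4) : ℝ) + 1) : ℝ) : ℂ)) =
        Complex.exp (Complex.I * ((k : ℂ) - (l : ℂ)) *
          ((Real.pi / 4 * (2 * ((0 : Fin 4) : ℝ) - 1) : ℝ) : ℂ)) := by
      rw [Complex.exp_eq_exp_iff_exists_int]
      refine ⟨(k : ℤ) - l, ?_⟩
      push_cast
      norm_num
      ring
    simp only [angular, integral_exp_mul_complex hc]
    rw [← Finset.sum_div, Fin.sum_univ_four, hp]
    norm_num

lemma angular_integral_eq (N : ℕ) (j : Fin 4) (k l : Fin N) (γ : ℝ)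
    (hγ : γ ∈ Set.Ioi (0 : ℝ)) :
    ∫ θ in (Real.pi / 4 * (2 * (j : ℝ) - 1))..(Real.pi / 4 * (2 * (j : ℝ) + 1)),
      (γ : ℂ) * vecMulVec (coherentState N ((γ : ℂ) * Complex.exp (Complex.I * (θ : ℂ))))
        (star (coherentState N ((γ : ℂ) * Complex.exp (Complex.I * (θ : ℂ))))) k l =
      (radial k l γ : ℂ) * angular k l j := by
  rw [angular, ← intervalIntegral.integral_const_mul]
  refine intervalIntegral.integral_congr fun θ _ => coherent_entry N hγ θ k l

lemma keyRegionOp_apply (N : ℕ) (z : Fin 4) (k l : Fin N) :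
    keyRegionOp N z k l = ((1 / Real.pi : ℝ) : ℂ) *
      (((∫ γ in Set.Ioi (0 : ℝ), radial k l γ : ℝ) : ℂ) * angular k l z) := by
  -- Dropping the null set `{0}` makes the factorisation for `γ > 0` available.
  rw [keyRegionOp, regionOp, of_apply, integral_Ici_eq_integral_Ioi,
    setIntegral_congr_fun measurableSet_Ioi (angular_integral_eq N z k l),
    integral_mul_const, integral_complex_ofReal]

theorem sum_keyRegionOp (N : ℕ) : ∑ z, keyRegionOp N z = 1 := by
  ext k l
  rw [Matrix.sum_apply]
  simp only [keyRegionOp_apply]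
  rw [← Finset.mul_sum, ← Finset.mul_sum, sum_angular, one_apply]
  by_cases h : k = l
  · subst h
    have : (Real.pi : ℂ) ≠ 0 := by exact_mod_cast Real.pi_ne_zero
    rw [if_pos rfl, if_pos rfl, integral_radial_self]
    push_cast
    field_simp
  · rw [if_neg h, if_neg (Fin.val_injective.ne h), mul_zero, mul_zero]

theorem posSemidef_keyRegionOp (N : ℕ) (z : Fin 4) : (keyRegionOp N z).PosSemidef := by
  set a := Real.pi / 4 * (2 * (z : ℝ) - 1) with ha
  set b := Real.pi / 4 * (2 * (z : ℝ) + 1) with hb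
  have hab : a ≤ b := mul_le_mul_of_nonneg_left (by linarith) (by positivity)
  let E (γ θ : ℝ) : Matrix (Fin N) (Fin N) ℂ := (γ : ℂ) •
    vecMulVec (coherentState N ((γ : ℂ) * Complex.exp (Complex.I * (θ : ℂ))))
      (star (coherentState N ((γ : ℂ) * Complex.exp (Complex.I * (θ : ℂ)))))
  have hE : keyRegionOp N z = ((1 / Real.pi : ℝ) : ℂ) •
      Matrix.of fun k l => ∫ γ in Set.Ioi (0 : ℝ),
        (Matrix.of fun k l => ∫ θ in Set.Ioc a b, E γ θ k l) k l := by
    ext k l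
    rw [keyRegionOp, regionOp, of_apply, integral_Ici_eq_integral_Ioi]
    simp only [intervalIntegral.integral_of_le hab, ← ha, ← hb]
    rfl
  rw [hE]
  refine PosSemidef.smul (posSemidef_integral ?_ fun k l => ?_)
    (by exact_mod_cast (one_div_pos.2 Real.pi_pos).le)
  · filter_upwards [ae_restrict_mem measurableSet_Ioi] with γ hγ
    refine posSemidef_integral (.of_forall fun θ => ?_) fun k l => ?_
    · exact (posSemidef_vecMulVec_self_star _).smul (by exact_mod_cast (le_of_lt hγ))
    · have : Continuous fun θ => E γ θ k l := by
        simp only [E, Matrix.smul_apply, coherent_entry N hγ, smul_eq_mul]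
        fun_prop
      exact (this.integrableOn_Icc (a := a) (b := b)).mono_set Set.Ioc_subset_Icc_self
  · have h : IntegrableOn (fun γ => (radial k l γ : ℂ) * angular k l z) (Set.Ioi 0) :=
      (Integrable.ofReal (integrableOn_radial k l)).mul_const _
    refine h.congr_fun (fun γ hγ => ?_) measurableSet_Ioi
    exact (angular_integral_eq N z k l γ hγ).symm.trans
      (intervalIntegral.integral_of_le hab)

end RegionOperators

/-! ### The isometry `G`, the pinching, and the objective as a real convex function -/

section Channels

open Matrix

lemma sq_cfc_sqrt {n : Type*} [Fintype n] [DecidableEq n] {A : Matrix n n ℂ} (hA : A.PosSemidef) :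
    (cfc Real.sqrt A)ᴴ * cfc Real.sqrt A = A := by
  have hc (f : ℝ → ℝ) : ContinuousOn f (spectrum ℝ A) :=
    (Matrix.finite_real_spectrum (A := A)).continuousOn f
  have hs : (cfc Real.sqrt A)ᴴ = cfc Real.sqrt A := cfc_predicate (p := IsSelfAdjoint) Real.sqrt A
  rw [hs, ← cfc_mul _ _ A (hc _) (hc _)]
  conv_rhs => rw [← cfc_id' ℝ A hA.1.isSelfAdjoint]
  refine cfc_congr fun x hx => ?_
  rw [hA.1.spectrum_real_eq_range_eigenvalues] at hx
  obtain ⟨i, rfl⟩ := hx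
  exact Real.mul_self_sqrt (hA.eigenvalues_nonneg i)

lemma krausG_apply (N : ℕ) (a : AB N × Fin 4) (j : AB N) :
    krausG N a j =
      ((1 : Matrix (Fin 4) (Fin 4) ℂ) ⊗ₖ cfc Real.sqrt (keyRegionOp N a.2)) a.1 j := by
  simp [krausG, Matrix.sum_apply]

theorem krausG_isometry (N : ℕ) : (krausG N)ᴴ * krausG N = 1 := by
  have h : (krausG N)ᴴ * krausG N =
      ∑ z, ((1 : Matrix (Fin 4) (Fin 4) ℂ) ⊗ₖ cfc Real.sqrt (keyRegionOp N z))ᴴ *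
        ((1 : Matrix (Fin 4) (Fin 4) ℂ) ⊗ₖ cfc Real.sqrt (keyRegionOp N z)) := by
    ext i j
    rw [mul_apply, Fintype.sum_prod_type_right, Matrix.sum_apply]
    refine Finset.sum_congr rfl fun z _ => ?_
    rw [mul_apply]
    refine Finset.sum_congr rfl fun a _ => ?_
    rw [conjTranspose_apply, conjTranspose_apply, krausG_apply, krausG_apply]
  rw [h]
  simp only [conjTranspose_kronecker, conjTranspose_one, ← mul_kronecker_mul, Matrix.one_mul,
    sq_cfc_sqrt (posSemidef_keyRegionOp N _)]
  rw [← one_kronecker_one, ← sum_keyRegionOp N]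
  ext i j
  simp [Matrix.sum_apply, kroneckerMap_apply, Finset.mul_sum]

lemma trace_mapG (N : ℕ) (ρ : Matrix (AB N) (AB N) ℂ) : (mapG N ρ).trace = ρ.trace := by
  rw [mapG, trace_mul_comm, ← Matrix.mul_assoc, krausG_isometry, Matrix.one_mul]

lemma posSemidef_mapG (N : ℕ) {ρ : Matrix (AB N) (AB N) ℂ} (hρ : ρ.PosSemidef) :
    (mapG N ρ).PosSemidef :=
  hρ.mul_mul_conjTranspose_same _

lemma mapG_add_smul (N : ℕ) (ρ σ : Matrix (AB N) (AB N) ℂ) (a b : ℝ) :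
    mapG N (a • ρ + b • σ) = a • mapG N ρ + b • mapG N σ := by
  simp only [mapG, Matrix.mul_add, Matrix.add_mul, Matrix.mul_smul, Matrix.smul_mul]

/-- The projection onto the `j`-th value of the register `Ẑ`. -/
def keyProj (N : ℕ) (j : Fin 4) : Matrix (AB N × Fin 4) (AB N × Fin 4) ℂ :=
  (1 : Matrix (AB N) (AB N) ℂ) ⊗ₖ Matrix.single j j (1 : ℂ)

lemma keyProj_conjTranspose (N : ℕ) (j : Fin 4) : (keyProj N j)ᴴ = keyProj N j := by
  simp [keyProj, conjTranspose_kronecker]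

lemma keyProj_mul (N : ℕ) (j k : Fin 4) :
    keyProj N j * keyProj N k = if j = k then keyProj N j else 0 := by
  rw [keyProj, keyProj, ← mul_kronecker_mul, Matrix.one_mul]
  split_ifs with h
  · subst h
    simp
  · rw [Matrix.single_mul_single_of_ne _ _ _ _ h, kronecker_zero]

lemma sum_keyProj (N : ℕ) : ∑ j, keyProj N j = 1 := by
  ext a b
  simp only [Matrix.sum_apply, keyProj, kroneckerMap_apply, ← Finset.mul_sum]
  rw [← Matrix.sum_apply, Matrix.sum_single_one, ← kroneckerMap_apply (· * ·),
    one_kronecker_one]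

lemma pinching_eq (N : ℕ) (X : Matrix (AB N × Fin 4) (AB N × Fin 4) ℂ) :
    pinching N X = ∑ j, keyProj N j * X * keyProj N j := by
  refine Finset.sum_congr rfl fun j _ => ?_
  conv_rhs => enter [2]; rw [← keyProj_conjTranspose]
  rfl

lemma pinching_add_smul (N : ℕ) (X Y : Matrix (AB N × Fin 4) (AB N × Fin 4) ℂ) (a b : ℝ) :
    pinching N (a • X + b • Y) = a • pinching N X + b • pinching N Y := by
  simp only [pinching_eq, mul_add, add_mul, Matrix.mul_smul, Matrix.smul_mul,
    Finset.sum_add_distrib, Finset.smul_sum]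

lemma posSemidef_pinching (N : ℕ) {X : Matrix (AB N × Fin 4) (AB N × Fin 4) ℂ}
    (hX : X.PosSemidef) : (pinching N X).PosSemidef :=
  posSemidef_sum _ fun _ _ => hX.mul_mul_conjTranspose_same _

/-- The pinching is self-adjoint for the trace pairing because its Kraus operators are Hermitian
projections. -/
lemma trace_mul_pinching (N : ℕ) (X Y : Matrix (AB N × Fin 4) (AB N × Fin 4) ℂ) :
    (X * pinching N Y).trace = (pinching N X * Y).trace := by
  simp only [pinching_eq, Finset.mul_sum, Finset.sum_mul, trace_sum]
  refine Finset.sum_congr rfl fun j _ => ?_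
  rw [← Matrix.mul_assoc, trace_mul_comm]
  simp only [Matrix.mul_assoc]

lemma trace_pinching (N : ℕ) (X : Matrix (AB N × Fin 4) (AB N × Fin 4) ℂ) :
    (pinching N X).trace = X.trace := by
  have h1 : pinching N (1 : Matrix (AB N × Fin 4) (AB N × Fin 4) ℂ) = 1 := by
    simp [pinching_eq, keyProj_mul, sum_keyProj]
  rw [← Matrix.mul_one (pinching N X), ← trace_mul_pinching, h1, Matrix.mul_one]

lemma keyProj_commute_pinching (N : ℕ) (X : Matrix (AB N × Fin 4) (AB N × Fin 4) ℂ) (j : Fin 4) :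
    Commute (pinching N X) (keyProj N j) := by
  have h1 : pinching N X * keyProj N j = keyProj N j * X * keyProj N j := by
    rw [pinching_eq, Finset.sum_mul]
    simp [Matrix.mul_assoc, keyProj_mul]
  have h2 : keyProj N j * pinching N X = keyProj N j * X * keyProj N j := by
    rw [pinching_eq, Finset.mul_sum]
    simp only [← Matrix.mul_assoc, keyProj_mul]
    simp [Matrix.mul_assoc]
  exact h1.trans h2.symm

/-- A pinched matrix commutes with every `keyProj`, hence so does any function of it, and
block-diagonal matrices are fixed by the pinching. -/
lemma pinching_cfc_pinching (N : ℕ) (X : Matrix (AB N × Fin 4) (AB N × Fin 4) ℂ) (f : ℝ → ℝ) :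
    pinching N (cfc f (pinching N X)) = cfc f (pinching N X) := by
  have h (j : Fin 4) : Commute (cfc f (pinching N X)) (keyProj N j) :=
    (keyProj_commute_pinching N X j).cfc_real f
  rw [pinching_eq]
  simp only [Matrix.mul_assoc, (h _).eq]
  simp only [← Matrix.mul_assoc, keyProj_mul, if_true]
  rw [← Finset.sum_mul, sum_keyProj, Matrix.one_mul]

/-- The form of the pinching at `v` is the sum of the nonnegative forms of `X` at the components
`keyProj N j *ᵥ v`. If it vanishes, `X` kills each component, hence `v`. So the infinite branch of
`relEntropy` never occurs for the objective. -/
lemma ker_pinching_le (N : ℕ) {X : Matrix (AB N × Fin 4) (AB N × Fin 4) ℂ} (hX : X.PosSemidef)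
    (v : AB N × Fin 4 → ℂ) (hv : pinching N X *ᵥ v = 0) : X *ᵥ v = 0 := by
  have h : ∑ j, star (keyProj N j *ᵥ v) ⬝ᵥ (X *ᵥ (keyProj N j *ᵥ v)) = 0 := by
    have h0 : star v ⬝ᵥ (pinching N X *ᵥ v) = 0 := by rw [hv, dotProduct_zero]
    rw [pinching_eq, sum_mulVec, dotProduct_sum] at h0
    rw [← h0]
    refine Finset.sum_congr rfl fun j _ => ?_
    rw [star_mulVec, keyProj_conjTranspose, ← dotProduct_mulVec, mulVec_mulVec, mulVec_mulVec,
      Matrix.mul_assoc]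
  rw [Finset.sum_eq_zero_iff_of_nonneg fun j _ => hX.dotProduct_mulVec_nonneg _] at h
  have h2 (j : Fin 4) : X *ᵥ (keyProj N j *ᵥ v) = 0 :=
    (hX.dotProduct_mulVec_zero_iff _).1 (h j (Finset.mem_univ j))
  rw [← one_mulVec v, ← sum_keyProj, sum_mulVec, mulVec_sum]
  exact Finset.sum_eq_zero fun j _ => h2 j

/-- Moving the pinching across the trace replaces `X` by its pinching next to `log (pinching N X)`.
The discontinuous logarithm then appears only inside `x log x`. -/
lemma relEnt_pinching (N : ℕ) {X : Matrix (AB N × Fin 4) (AB N × Fin 4) ℂ} (hX : X.PosSemidef) :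
    relEnt X (pinching N X) = (cfc (fun x => x * Real.logb 2 x) X).trace.re -
      (cfc (fun x => x * Real.logb 2 x) (pinching N X)).trace.re := by
  have h (A : Matrix (AB N × Fin 4) (AB N × Fin 4) ℂ) (hA : A.IsHermitian) :
      A * cfc (Real.logb 2) A = cfc (fun x => x * Real.logb 2 x) A := by
    have hc (f : ℝ → ℝ) : ContinuousOn f (spectrum ℝ A) :=
      (Matrix.finite_real_spectrum (A := A)).continuousOn f
    rw [cfc_mul _ _ A (hc _) (hc _), cfc_id' ℝ A]
  rw [relEnt, mul_sub, trace_sub, Complex.sub_re, h X hX.1, ← pinching_cfc_pinching,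
    trace_mul_pinching, h _ (posSemidef_pinching N hX).1]

/-- The objective on density matrices, as a real number. -/
def realObjective (N : ℕ) (ρ : Matrix (AB N) (AB N) ℂ) : ℝ :=
  relEnt (mapG N ρ) (pinching N (mapG N ρ))

lemma objective_eq (N : ℕ) {ρ : Matrix (AB N) (AB N) ℂ} (hρ : IsDensity ρ) :
    objective N ρ = (realObjective N ρ : EReal) := by
  rw [objective, relEntropy, if_pos (ker_pinching_le N (posSemidef_mapG N hρ.1)), trace_mapG,
    hρ.2, Complex.one_re, inv_one, one_mul]
  rfl

lemma IsDensity.convex_comb {n : Type*} [Fintype n] {ρ σ : Matrix n n ℂ} (hρ : IsDensity ρ)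
    (hσ : IsDensity σ) {a b : ℝ} (ha : 0 ≤ a) (hb : 0 ≤ b) (hab : a + b = 1) :
    IsDensity (a • ρ + b • σ) := by
  refine ⟨(hρ.1.smul ha).add (hσ.1.smul hb), ?_⟩
  rw [trace_add, trace_smul, trace_smul, hρ.2, hσ.2, ← add_smul, hab, one_smul]

theorem realObjective_add_smul_le (N : ℕ) {ρ σ : Matrix (AB N) (AB N) ℂ} (hρ : ρ.PosSemidef)
    (hσ : σ.PosSemidef) {a b : ℝ} (ha : 0 ≤ a) (hb : 0 ≤ b) :
    realObjective N (a • ρ + b • σ) ≤ a * realObjective N ρ + b * realObjective N σ := by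
  have h1 := posSemidef_mapG N hρ
  have h2 := posSemidef_mapG N hσ
  have h := (h1.smul ha).add (h2.smul hb)
  have hp := posSemidef_pinching N h
  have hk := ker_pinching_le N h
  rw [pinching_add_smul] at hp hk
  rw [realObjective, mapG_add_smul, pinching_add_smul]
  exact relEnt_add_smul_le h1 h2 (posSemidef_pinching N h1) (posSemidef_pinching N h2) ha hb h hp
    (ker_pinching_le N h1) (ker_pinching_le N h2) hk

end Channels

/-! ### Compactness of the density matrices and continuity of the functional calculus -/

section Compactness

open Matrix
open scoped Matrix.Norms.L2Operator

variable {n : Type*} [Fintype n] [DecidableEq n]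

lemma IsDensity.spectrum_subset {ρ : Matrix n n ℂ} (hρ : IsDensity ρ) :
    spectrum ℝ ρ ⊆ Set.Icc 0 1 := by
  rw [hρ.1.1.spectrum_real_eq_range_eigenvalues]
  rintro _ ⟨i, rfl⟩
  refine ⟨hρ.1.eigenvalues_nonneg i, ?_⟩
  have h := hρ.2
  rw [hρ.1.1.trace_eq_sum_eigenvalues] at h
  have h' : ∑ i, hρ.1.1.eigenvalues i = 1 := by
    simpa using congrArg Complex.re h
  rw [← h']
  exact Finset.single_le_sum (f := hρ.1.1.eigenvalues)
    (fun i _ => hρ.1.eigenvalues_nonneg i) (Finset.mem_univ i)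

omit [DecidableEq n] in
lemma isClosed_isDensity : IsClosed {ρ : Matrix n n ℂ | IsDensity ρ} := by
  simp only [IsDensity, posSemidef_iff_dotProduct_mulVec, IsHermitian, Set.ofPred_and,
    Set.ofPred_forall]
  refine ((isClosed_eq (by fun_prop) (by fun_prop)).inter (isClosed_iInter fun v => ?_)).inter
    (isClosed_eq (by fun_prop) (by fun_prop))
  exact isClosed_le continuous_const (by fun_prop)

lemma isCompact_isDensity : IsCompact {ρ : Matrix n n ℂ | IsDensity ρ} := by
  have : ProperSpace (Matrix n n ℂ) := FiniteDimensional.proper ℂ _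
  refine Metric.isCompact_of_isClosed_isBounded isClosed_isDensity
    (isBounded_iff_forall_norm_le.2 ⟨1, fun ρ hρ => ?_⟩)
  rw [← cfc_id' ℝ ρ hρ.1.1.isSelfAdjoint]
  refine norm_cfc_le zero_le_one fun x hx => ?_
  have := hρ.spectrum_subset hx
  rw [Real.norm_of_nonneg this.1]
  exact this.2

lemma continuousOn_cfc_isDensity (f : ℝ → ℝ) (hf : Continuous f) :
    ContinuousOn (fun ρ : Matrix n n ℂ => cfc f ρ) {ρ | IsDensity ρ} :=
  (continuousOn_cfc (Matrix n n ℂ) isCompact_Icc f hf.continuousOn).mono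
    fun _ hρ => ⟨hρ.1.1.isSelfAdjoint, hρ.spectrum_subset⟩

end Compactness

/-! ### Existence of minimisers and convexity of the optimal value -/

section Minimisation

open Matrix

lemma continuous_mul_logb : Continuous fun x : ℝ => x * Real.logb 2 x := by
  simpa only [Real.logb, mul_div_assoc] using Real.continuous_mul_log.div_const (Real.log 2)

lemma IsDensity.mapG {N : ℕ} {ρ : Matrix (AB N) (AB N) ℂ} (hρ : IsDensity ρ) :
    IsDensity (mapG N ρ) :=
  ⟨posSemidef_mapG N hρ.1, by rw [trace_mapG, hρ.2]⟩

lemma IsDensity.pinching {N : ℕ} {X : Matrix (AB N × Fin 4) (AB N × Fin 4) ℂ} (hX : IsDensity X) :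
    IsDensity (pinching N X) :=
  ⟨posSemidef_pinching N hX.1, by rw [trace_pinching, hX.2]⟩

lemma continuousOn_realObjective (N : ℕ) :
    ContinuousOn (realObjective N) {ρ | IsDensity ρ} := by
  have hm : Continuous (mapG N) := by
    unfold mapG
    fun_prop
  have hp : Continuous (pinching N) := by
    unfold pinching
    fun_prop
  have h1 := (continuousOn_cfc_isDensity _ continuous_mul_logb).comp hm.continuousOn
    (fun ρ (hρ : IsDensity ρ) => hρ.mapG)
  have h2 := (continuousOn_cfc_isDensity _ continuous_mul_logb).comp (hp.comp hm).continuousOn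
    (fun ρ (hρ : IsDensity ρ) => hρ.mapG.pinching)
  have ht : Continuous fun X : Matrix (AB N × Fin 4) (AB N × Fin 4) ℂ => X.trace.re :=
    Complex.continuous_re.comp (by fun_prop)
  refine ((ht.comp_continuousOn h1).sub (ht.comp_continuousOn h2)).congr fun ρ hρ => ?_
  exact relEnt_pinching N (posSemidef_mapG N hρ.1)

variable {N K : ℕ} {δ : ℝ} {Γ : Fin 16 → Matrix (Fin 4) (Fin 4) ℂ} {qPE qTom : ℝ}

/-- The channel output is diagonal and `testOS` is a function of `c`, so exactly one term survives.
Feasibility thus becomes finitely many linear equations in `ρ`. -/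
lemma traceFst_testChannel (ρ : Matrix (AB N) (AB N) ℂ) (c : TestAlphabet K) :
    traceFst (testChannel N K δ Γ qPE qTom ρ) c c =
      (testEffect N K δ Γ qPE qTom c * ρ).trace := by
  simp only [traceFst, testChannel, of_apply, Matrix.sum_apply, Matrix.smul_apply, single_apply,
    Prod.mk.injEq, smul_eq_mul, mul_ite, mul_one, mul_zero, ite_and]
  rw [Finset.sum_comm]
  simp

lemma mem_feasible {p : TestAlphabet K → ℝ} {ρ : Matrix (AB N) (AB N) ℂ} :
    ρ ∈ feasible N K δ Γ qPE qTom p ↔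
      IsDensity ρ ∧ ∀ c, (testEffect N K δ Γ qPE qTom c * ρ).trace = (p c : ℂ) := by
  simp only [feasible, traceFst_testChannel, Set.mem_ofPred_eq]

lemma isCompact_feasible (p : TestAlphabet K → ℝ) :
    IsCompact (feasible N K δ Γ qPE qTom p) := by
  have h : feasible N K δ Γ qPE qTom p = {ρ | IsDensity ρ} ∩
      ⋂ c, {ρ | (testEffect N K δ Γ qPE qTom c * ρ).trace = (p c : ℂ)} := by
    ext ρ
    simp [mem_feasible]
  rw [h]
  exact isCompact_isDensity.inter_right
    (isClosed_iInter fun c => isClosed_eq (by fun_prop) continuous_const)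

lemma feasible_add_smul {p q : TestAlphabet K → ℝ} {ρ σ : Matrix (AB N) (AB N) ℂ}
    (hρ : ρ ∈ feasible N K δ Γ qPE qTom p) (hσ : σ ∈ feasible N K δ Γ qPE qTom q) {a b : ℝ}
    (ha : 0 ≤ a) (hb : 0 ≤ b) (hab : a + b = 1) :
    a • ρ + b • σ ∈ feasible N K δ Γ qPE qTom (a • p + b • q) := by
  rw [mem_feasible] at *
  refine ⟨hρ.1.convex_comb hσ.1 ha hb hab, fun c => ?_⟩
  rw [mul_add, Matrix.mul_smul, Matrix.mul_smul, trace_add, trace_smul, trace_smul, hρ.2, hσ.2]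
  simp

theorem exists_minimiser {p : TestAlphabet K → ℝ} (hne : (feasible N K δ Γ qPE qTom p).Nonempty)
    (pkey : ℝ) :
    ∃ ρ ∈ feasible N K δ Γ qPE qTom p,
      (∀ σ ∈ feasible N K δ Γ qPE qTom p, objective N ρ ≤ objective N σ) ∧
        g N K δ Γ qPE qTom pkey p = (pkey : EReal) * objective N ρ := by
  obtain ⟨ρ, hρ, hmin⟩ := (isCompact_feasible p).exists_isMinOn hne
    ((continuousOn_realObjective N).mono fun _ h => h.1)
  have hle : ∀ σ ∈ feasible N K δ Γ qPE qTom p, objective N ρ ≤ objective N σ := fun σ hσ => by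
    rw [objective_eq N hρ.1, objective_eq N hσ.1]
    exact EReal.coe_le_coe_iff.2 (hmin hσ)
  refine ⟨ρ, hρ, hle, ?_⟩
  rw [g, le_antisymm (iInf₂_le ρ hρ) (le_iInf₂ hle)]

lemma g_eq_top {pkey : ℝ} (hkey : 0 < pkey) {p : TestAlphabet K → ℝ}
    (h : ¬ (feasible N K δ Γ qPE qTom p).Nonempty) : g N K δ Γ qPE qTom pkey p = ⊤ := by
  rw [g, Set.not_nonempty_iff_eq_empty.1 h]
  simp [EReal.coe_mul_top_of_pos hkey]

lemma exists_minimiser_coe {p : TestAlphabet K → ℝ}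
    (hne : (feasible N K δ Γ qPE qTom p).Nonempty) (pkey : ℝ) :
    ∃ ρ ∈ feasible N K δ Γ qPE qTom p,
      g N K δ Γ qPE qTom pkey p = ((pkey * realObjective N ρ : ℝ) : EReal) := by
  obtain ⟨ρ, hρ, -, h⟩ := exists_minimiser hne pkey
  exact ⟨ρ, hρ, by rw [h, objective_eq N hρ.1, EReal.coe_mul]⟩

/-- Needed because `⊤ + ⊥ = ⊥` in `EReal`: an infinite term makes the right-hand side of the
convexity inequality infinite only if the other term is not `⊥`. -/
lemma coe_mul_g_ne_bot {pkey : ℝ} (hkey : 0 < pkey) {a : ℝ} (ha : 0 < a)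
    (p : TestAlphabet K → ℝ) : (a : EReal) * g N K δ Γ qPE qTom pkey p ≠ ⊥ := by
  by_cases h : (feasible N K δ Γ qPE qTom p).Nonempty
  · obtain ⟨ρ, -, e⟩ := exists_minimiser_coe h pkey
    rw [e, ← EReal.coe_mul]
    exact EReal.coe_ne_bot _
  · simp [g_eq_top hkey h, EReal.coe_mul_top_of_pos ha]

theorem g_add_smul_le {pkey : ℝ} (hkey : 0 < pkey) (p q : TestAlphabet K → ℝ) {a b : ℝ}
    (ha : 0 < a) (hb : 0 < b) (hab : a + b = 1) :
    g N K δ Γ qPE qTom pkey (a • p + b • q) ≤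
      (a : EReal) * g N K δ Γ qPE qTom pkey p + (b : EReal) * g N K δ Γ qPE qTom pkey q := by
  by_cases hp : (feasible N K δ Γ qPE qTom p).Nonempty
  swap
  · rw [g_eq_top hkey hp, EReal.coe_mul_top_of_pos ha,
      EReal.top_add_of_ne_bot (coe_mul_g_ne_bot hkey hb q)]
    exact le_top
  by_cases hq : (feasible N K δ Γ qPE qTom q).Nonempty
  swap
  · rw [g_eq_top hkey hq, EReal.coe_mul_top_of_pos hb,
      EReal.add_top_of_ne_bot (coe_mul_g_ne_bot hkey ha p)]
    exact le_top
  obtain ⟨ρ, hρ, eρ⟩ := exists_minimiser_coe hp pkey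
  obtain ⟨σ, hσ, eσ⟩ := exists_minimiser_coe hq pkey
  have hmix := feasible_add_smul hρ hσ ha.le hb.le hab
  obtain ⟨τ, hτ, hmin, eτ⟩ := exists_minimiser ⟨_, hmix⟩ pkey
  have h1 := hmin _ hmix
  rw [objective_eq N hτ.1, objective_eq N hmix.1, EReal.coe_le_coe_iff] at h1
  rw [eτ, eρ, eσ, objective_eq N hτ.1]
  norm_cast
  have h2 := h1.trans (realObjective_add_smul_le N hρ.1.1 hσ.1.1 ha.le hb.le)
  have h3 := mul_le_mul_of_nonneg_left h2 hkey.le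
  linarith

end Minimisation

end CVQKD

end

theorem lemma4
    (N K : ℕ) (δ : ℝ) (hδ : 0 < δ)
    (Γ : Fin 16 → Matrix (Fin 4) (Fin 4) ℂ) (hΓ : CVQKD.IsICPOVM Γ)
    (pkey pPE pTom : ℝ) (hkey : 0 < pkey) (hPE : 0 ≤ pPE) (hTom : 0 ≤ pTom)
    (hsum : pkey + pPE + pTom = 1)
    -- conditional probabilities of the two kinds of test rounds, given a test round
    (qPE qTom : ℝ) (hqPE : 0 ≤ qPE) (hqTom : 0 ≤ qTom) (hq : qPE + qTom = 1)
    (hqPE' : pPE = (1 - pkey) * qPE) (hqTom' : pTom = (1 - pkey) * qTom) :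
    -- the minimum defining `g` exists and is finite wherever there is a feasible state
    (∀ p ∈ stdSimplex ℝ (CVQKD.TestAlphabet K),
      (CVQKD.feasible N K δ Γ qPE qTom p).Nonempty →
        ∃ ρ ∈ CVQKD.feasible N K δ Γ qPE qTom p,
          (∀ σ ∈ CVQKD.feasible N K δ Γ qPE qTom p,
            CVQKD.objective N ρ ≤ CVQKD.objective N σ) ∧
          CVQKD.objective N ρ ≠ ⊤ ∧
          CVQKD.g N K δ Γ qPE qTom pkey p = (pkey : EReal) * CVQKD.objective N ρ) ∧
    -- `g` is convex on the probability distributions on the test alphabet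
    (∀ p ∈ stdSimplex ℝ (CVQKD.TestAlphabet K), ∀ q ∈ stdSimplex ℝ (CVQKD.TestAlphabet K),
      ∀ t : ℝ, 0 ≤ t → t ≤ 1 →
        CVQKD.g N K δ Γ qPE qTom pkey (t • p + (1 - t) • q) ≤
          (t : EReal) * CVQKD.g N K δ Γ qPE qTom pkey p +
            ((1 - t : ℝ) : EReal) * CVQKD.g N K δ Γ qPE qTom pkey q) := by
  refine ⟨fun p _ hne => ?_, fun p _ q _ t ht0 ht1 => ?_⟩
  · obtain ⟨ρ, hρ, hmin, hg⟩ := CVQKD.exists_minimiser hne pkey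
    refine ⟨ρ, hρ, hmin, ?_, hg⟩
    rw [CVQKD.objective_eq N hρ.1]
    exact EReal.coe_ne_top _
  -- At the endpoints one term has weight zero and may be `0 * ⊤ = 0`, so the argument with positive
  -- weights does not apply; the inequality is then trivial.
  · rcases ht0.eq_or_lt with rfl | ht0
    · simp
    rcases ht1.eq_or_lt with rfl | ht1
    · simp
    exact CVQKD.g_add_smul_le hkey p q ht0 (sub_pos.2 ht1) (add_sub_cancel _ _)
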